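/- Let $\Phi$ be a (finite, reduced, crystallographic) root system with a chosen set of simple roots $\alpha_1,\dots,\alpha_r$, positive roots $\Phi_+$, coroots $h_\alpha$, and Weyl group $W$ with length function $\ell$ relative to the simple reflections. For $\alpha\in\Phi_+$ with $h_\alpha=d_1h_{\alpha_1}+\dots+d_rh_{\alpha_r}$ put $|h_\alpha|=d_1+\dots+d_r$ and $q^{h_\alpha}=q_1^{d_1}\cdots q_r^{d_r}\in\mathbb{Z}[q_1,\dots,q_r]$. The quantum Bruhat graph $\Gamma_\Phi$ is the directed graph with vertex set $W$ in which there is an edge $u\to v$ if and only if $v=us_\alpha$ for some $\alpha\in\Phi_+$ such that $\ell(v)=\ell(u)+1$ or $\ell(v)=\ell(u)+1-2|h_\alpha|$; the weight of the edge is $1$ in the first case and $q^{h_\alpha}$ in the second. The weight of a directed path is the product of the weights of its edges, and a directed path from $u$ to $v$ is called shortest if it has the minimal possible number of edges among all directed paths from $u$ to $v$. Let $u,v\in W$ be any two elements. Then (1) there exists a directed path from $u$ to $v$ in $\Gamma_\Phi$; and there is $d_{\min}=d_{\min}(u,v)\in\mathbb{Z}_{\ge 0}^r$ such that (2) all shortest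 paths from $u$ to $v$ have the same weight $q^{d_{\min}}$, and (3) the weight of every directed path from $u$ to $v$ is divisible by $q^{d_{\min}}$. -/

import Mathlib

namespace RootPairing.Base

variable {ι R M N : Type*} [Field R] [CharZero R] [AddCommGroup M] [Module R M]
  [AddCommGroup N] [Module R N] {P : RootPairing ι R M N}

/-- The simple reflection `s_j`, as an element of the Weyl group. -/
def simpleReflection (b : P.Base) (j : b.support) : P.weylGroup :=
  RootPairing.weylGroup.ofIdx P j

/-- The length of a Weyl group element `w`: the minimal number of simple reflections in a
decomposition of `w` (a decomposition exists by `exists_word`). -/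
noncomputable def weylLength (b : P.Base) (w : P.weylGroup) : ℕ :=
  sInf {n | ∃ l : List b.support, l.length = n ∧ (l.map b.simpleReflection).prod = w}

/-- The exponent vector `d = (d_j)` of a coroot `h_α = ∑ d_j h_{α_j}`, `α` a positive root (see
`coroot_eq_sum_corootExponent`). For a negative root these are the coefficients of `-h_α`. -/
noncomputable def corootExponent (b : P.Base) (i : ι) : b.support →₀ ℕ :=
  Finsupp.equivFunOnFinite.symm fun j => (b.flip.exists_root_eq_sum_nat_or_neg i).choose j

/-- The height `|h_α| = ∑ d_j` of the coroot `h_α` of a positive root `α`. -/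
noncomputable def corootHeight (b : P.Base) (i : ι) : ℕ :=
  ∑ j, b.corootExponent i j

theorem exists_word [Finite ι] [P.IsCrystallographic] [P.IsReduced] (b : P.Base)
    (w : P.weylGroup) : ∃ l : List b.support, (l.map b.simpleReflection).prod = w := by
  have mulmem : ∀ x y : P.weylGroup,
      (∃ l : List b.support, (l.map b.simpleReflection).prod = x) →
      (∃ l : List b.support, (l.map b.simpleReflection).prod = y) →
      ∃ l : List b.support, (l.map b.simpleReflection).prod = x * y := by
    rintro x y ⟨l, rfl⟩ ⟨m, rfl⟩
    exact ⟨l ++ m, by simp⟩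
  have conj : ∀ i j : ι, RootPairing.weylGroup.ofIdx P (P.reflectionPerm j i) =
      RootPairing.weylGroup.ofIdx P j * RootPairing.weylGroup.ofIdx P i *
        RootPairing.weylGroup.ofIdx P j := by
    intro i j
    apply Subtype.ext
    apply RootPairing.Equiv.weightHom_injective P
    ext x
    change P.reflection (P.reflectionPerm j i) x =
      P.reflection j (P.reflection i (P.reflection j x))
    rw [RootPairing.reflection_reflectionPerm]
    rfl
  have refl : ∀ i : ι, ∃ l : List b.support,
      (l.map b.simpleReflection).prod = RootPairing.weylGroup.ofIdx P i := by
    intro i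
    have sim : ∀ j ∈ b.support, ∃ l : List b.support,
        (l.map b.simpleReflection).prod = RootPairing.weylGroup.ofIdx P j :=
      fun j hj => ⟨[⟨j, hj⟩], by simp [simpleReflection]⟩
    refine b.induction_reflect i (fun j hj => ?_) sim (fun i j hi hj => ?_)
    · rw [conj]
      exact mulmem _ _ (mulmem _ _ hj hj) hj
    · rw [conj]
      exact mulmem _ _ (mulmem _ _ (sim j hj) hi) (sim j hj)
  obtain ⟨w, hw⟩ := w
  induction hw using RootPairing.weylGroup.induction with
  | mem i => exact refl i
  | one => exact ⟨[], rfl⟩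
  | mul x y hx hy h1 h2 => exact mulmem ⟨x, hx⟩ ⟨y, hy⟩ h1 h2

theorem isPos_flip [Finite ι] [P.IsCrystallographic] [P.IsReduced] (b : P.Base) {i : ι}
    (hi : b.IsPos i) : b.flip.IsPos i := by
  let := P.indexNeg
  have neg : ∀ k, b.IsPos k → ¬ b.IsPos (P.reflectionPerm k k) := fun k hk h =>
    (IsPos.neg_iff_not b k).1 h hk
  suffices h : b.IsPos i → b.flip.IsPos i from h hi
  refine hi.induction_on_reflect (p := fun k => b.IsPos k → b.flip.IsPos k)
    (fun k hk _ => isPos_of_mem_support (b := b.flip) hk) (fun i j h hj hk => ?_)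
  have hjf : j ∈ b.flip.support := hj
  by_cases hkj : P.reflectionPerm j i = j
  · rw [hkj]
    exact isPos_of_mem_support hjf
  · have hi' : b.IsPos i := by simpa using hk.reflectionPerm hj hkj
    have hij : i ≠ j := by
      rintro rfl
      exact neg i hi' hk
    exact (h hi').reflectionPerm hjf hij

theorem coroot_eq_sum_corootExponent [Finite ι] [P.IsCrystallographic] [P.IsReduced]
    (b : P.Base) {i : ι} (hi : b.IsPos i) :
    P.coroot i = ∑ j : b.support, b.corootExponent i j • P.coroot j := by
  have hpos := b.isPos_flip hi
  obtain ⟨-, h | h⟩ := (b.flip.exists_root_eq_sum_nat_or_neg i).choose_spec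
  · refine Eq.trans h ?_
    exact (Finset.sum_coe_sort b.support
      (fun j => (b.flip.exists_root_eq_sum_nat_or_neg i).choose j • P.coroot j)).symm
  · exfalso
    set f := (b.flip.exists_root_eq_sum_nat_or_neg i).choose
    have h' : P.flip.root i = ∑ j ∈ b.flip.support, (-(f j : ℤ)) • P.flip.root j := by
      rw [h]; simp
    rw [isPos_iff, height_eq_sum (f := fun j => -(f j : ℤ)) h', Finset.sum_neg_distrib] at hpos
    have : (0 : ℤ) ≤ ∑ j ∈ b.flip.support, (f j : ℤ) :=
      Finset.sum_nonneg fun j _ => Int.natCast_nonneg _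
    omega

/-- The vertex set of the quantum Bruhat graph: the elements of the Weyl group. -/
def QuantumBruhatGraph (_b : P.Base) : Type _ := P.weylGroup

/-- A directed edge `u ⟶ v` of the quantum Bruhat graph: a positive root `α` with `v = u s_α` and
`ℓ(v) = ℓ(u) + 1` or `ℓ(v) = ℓ(u) + 1 - 2|h_α|`. As the root system is reduced, `α` is determined
by `u` and `v`, so there is at most one edge from `u` to `v`. -/
structure QuantumBruhatEdge (b : P.Base) (u v : P.weylGroup) where
  /-- the (index of the) root labelling the edge -/
  root : ι
  isPos : b.IsPos root
  eq_mul : v = u * RootPairing.weylGroup.ofIdx P root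
  length_eq : (b.weylLength v : ℤ) = b.weylLength u + 1 ∨
    (b.weylLength v : ℤ) = b.weylLength u + 1 - 2 * b.corootHeight root

/-- The quantum Bruhat graph; its directed paths are the terms of `Quiver.Path`. -/
instance (b : P.Base) : Quiver b.QuantumBruhatGraph where
  Hom u v := b.QuantumBruhatEdge u v

/-- The monomial `q^d = ∏ q_j ^ d_j` in `ℤ[q]`, one variable for each simple root. -/
noncomputable def qMonomial (b : P.Base) (d : b.support →₀ ℕ) : MvPolynomial b.support ℤ :=
  MvPolynomial.monomial d 1

open Classical in
/-- The weight of an edge `u ⟶ v` labelled by `α`: it is `1` if `ℓ(v) = ℓ(u) + 1`, and `q^{h_α}`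
otherwise, that is, if `ℓ(v) = ℓ(u) + 1 - 2|h_α|` (the two cases exclude each other, as
`|h_α| > 0`). -/
noncomputable def edgeWeight (b : P.Base) {u v : b.QuantumBruhatGraph} (e : u ⟶ v) :
    MvPolynomial b.support ℤ :=
  if b.weylLength v = b.weylLength u + 1 then 1
  else b.qMonomial (b.corootExponent (QuantumBruhatEdge.root e))

/-- The weight of a directed path: the product of the weights of its edges. -/
noncomputable def pathWeight (b : P.Base) {u v : b.QuantumBruhatGraph} (p : Quiver.Path u v) :
    MvPolynomial b.support ℤ :=
  p.weight b.edgeWeight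

/-- A path from `u` to `v` is shortest if it has the minimal possible number of edges among all
directed paths from `u` to `v`. -/
def IsShortestPath (b : P.Base) {u v : b.QuantumBruhatGraph} (p : Quiver.Path u v) : Prop :=
  ∀ p' : Quiver.Path u v, p.length ≤ p'.length

end RootPairing.Base

/-!
Only the weights of paths matter, not their numbers of edges: an edge of weight `q ^ d` from `u` to
`v` satisfies `ℓ(v) = ℓ(u) + 1 - 2|d|`, so a path of weight `q ^ d` from `u` to `v` has exactly
`ℓ(v) - ℓ(u) + 2|d|` edges (`HasPath.length_nonneg`, `HasExponent.length_eq`). A shortest path is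
one for which `|d|` is minimal, and it suffices to show that the set `D(u, v)` of the exponents of
all paths from `u` to `v` is nonempty and has a least element (`hasLeastWeight`).

The least element is found by means of the affine Weyl group, acting through left multiplication
on pairs `(u, v)`. The *affine simple* roots `a` (`IsAffineSimple`) include the simple roots and the
roots `-θ` for `θ` a maximal root, one for each irreducible component. If `x⁻¹ a` is positive,
then there is an edge `x ⟶ s_a x`, whose weight is `1` for `a` simple and `q ^ h` with `h` the
coroot of `x⁻¹ a` for `a = -θ`. The length formula `IsAffineSimple.weylLength_mul` that gives this
comes from counting inversions.

Call `x` lower and `s_a x` upper in this situation. An edge `u ⟶ v` between two lower or two upper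
elements gives an edge `s_a u ⟶ s_a v` (`IsAffineSimple.hasPath_of_isStep`), and an edge from a
lower to an upper element can only be `u ⟶ s_a u` (`IsAffineSimple.eq_of_isStep`); an edge from an
upper to a lower element extends to a path `s_a u ⟶ u ⟶ v ⟶ s_a v`. Hence replacing each vertex
`x` of a path by the lower, or by the upper, of `x` and `s_a x` again gives a path, and the weight
changes by an amount that depends only on the end points (`IsAffineSimple.hasPath_lowerRep`,
`IsAffineSimple.hasPath_upperRep`). If `v` is an upper element for `a`, then `D(u, v)` is
therefore a translate of `D(u', s_a v)` with `u'` the lower one of `u` and `s_a u`. In passing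
from `(u, v)` to `(u', s_a v)` the minimal number of edges drops by one if `u' = u`, and does not
change if `u' = s_a u`.

It remains to see that for `u ≠ v` the case `u' = u` occurs after finitely many steps of this kind.
As long as it does not, `y = v⁻¹ u` is constant. The steps correspond to crossings of affine
hyperplanes, and the affine simple roots can be chosen so that at least one hyperplane orthogonal
to each positive root is crossed: otherwise more than two hyperplanes orthogonal to some root remain
to be crossed, while no crossing is possible, which contradicts the fact that the maximal roots
bound the remaining crossings (`crossings_le_two`). Take a positive root `γ` with `y⁻¹ γ` negative;
when a hyperplane orthogonal to `γ` is crossed, `u` is a lower element.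
-/

/-! ### The action of the Weyl group on roots, and coordinates -/

namespace RootPairing

section WeylAction

variable {ι R M N : Type*} [CommRing R] [AddCommGroup M] [Module R M]
  [AddCommGroup N] [Module R N] {P : RootPairing ι R M N}

/-- The Weyl group acts on the index set of the roots. -/
noncomputable instance weylGroupMulAction : MulAction P.weylGroup ι := MulAction.compHom ι P.weylGroupToPerm

theorem ofIdx_smul_index (i j : ι) : weylGroup.ofIdx P i • j = P.reflectionPerm i j := rfl

theorem root_smul_index (w : P.weylGroup) (i : ι) : P.root (w • i) = w • P.root i :=
  (P.weylGroup_apply_root w i).symm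

theorem ofIdx_mul_self (i : ι) : weylGroup.ofIdx P i * weylGroup.ofIdx P i = 1 := by
  apply Subtype.ext
  apply RootPairing.Equiv.weightHom_injective P
  ext x
  change P.reflection i (P.reflection i x) = x
  simp

theorem ofIdx_inv (i : ι) : (weylGroup.ofIdx P i)⁻¹ = weylGroup.ofIdx P i :=
  inv_eq_of_mul_eq_one_left (ofIdx_mul_self i)

theorem ofIdx_mul_ofIdx_mul (i : ι) (w : P.weylGroup) :
    weylGroup.ofIdx P i * (weylGroup.ofIdx P i * w) = w := by
  rw [← mul_assoc, ofIdx_mul_self, one_mul]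

theorem mul_ofIdx_mul_ofIdx (i : ι) (w : P.weylGroup) :
    w * weylGroup.ofIdx P i * weylGroup.ofIdx P i = w := by
  rw [mul_assoc, ofIdx_mul_self, mul_one]

theorem ofIdx_smul (w : P.weylGroup) (i : ι) :
    weylGroup.ofIdx P (w • i) = w * weylGroup.ofIdx P i * w⁻¹ := by
  have conj : ∀ i j : ι, weylGroup.ofIdx P (P.reflectionPerm j i) =
      weylGroup.ofIdx P j * weylGroup.ofIdx P i * (weylGroup.ofIdx P j)⁻¹ := by
    intro i j
    rw [ofIdx_inv]
    apply Subtype.ext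
    apply RootPairing.Equiv.weightHom_injective P
    ext x
    change P.reflection (P.reflectionPerm j i) x =
      P.reflection j (P.reflection i (P.reflection j x))
    rw [RootPairing.reflection_reflectionPerm]
    rfl
  obtain ⟨w, hw⟩ := w
  induction hw using RootPairing.weylGroup.induction generalizing i with
  | mem j => exact conj i j
  | one =>
    change weylGroup.ofIdx P ((1 : P.weylGroup) • i) =
      (1 : P.weylGroup) * weylGroup.ofIdx P i * (1 : P.weylGroup)⁻¹
    simp
  | mul x y hx hy h1 h2 =>
    change weylGroup.ofIdx P (((⟨x, hx⟩ * ⟨y, hy⟩ : P.weylGroup)) • i) =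
      (⟨x, hx⟩ * ⟨y, hy⟩ : P.weylGroup) * weylGroup.ofIdx P i * (⟨x, hx⟩ * ⟨y, hy⟩ : P.weylGroup)⁻¹
    rw [mul_smul, h1, h2]
    group

theorem mul_ofIdx (w : P.weylGroup) (i : ι) :
    w * weylGroup.ofIdx P i = weylGroup.ofIdx P (w • i) * w := by
  rw [ofIdx_smul]; group

theorem ofIdx_mul (w : P.weylGroup) (i : ι) :
    weylGroup.ofIdx P i * w = w * weylGroup.ofIdx P (w⁻¹ • i) := by
  rw [ofIdx_smul]; group

variable (P) in
/-- The index of the negative of the root with index `i`. -/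
def negIndex (i : ι) : ι := P.reflectionPerm i i

theorem root_negIndex (i : ι) : P.root (P.negIndex i) = -P.root i := by
  simp [negIndex]

theorem negIndex_negIndex (i : ι) : P.negIndex (P.negIndex i) = i := by
  apply P.root.injective
  simp [root_negIndex]

theorem smul_negIndex (w : P.weylGroup) (i : ι) : w • P.negIndex i = P.negIndex (w • i) := by
  rw [negIndex, negIndex, ← ofIdx_smul_index, ← ofIdx_smul_index, ← mul_smul, ofIdx_smul]
  simp [mul_smul]

theorem negIndex_eq_iff {i j : ι} : P.negIndex i = j ↔ i = P.negIndex j := by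
  constructor <;> rintro rfl <;> simp [negIndex_negIndex]

theorem ofIdx_negIndex (i : ι) : weylGroup.ofIdx P (P.negIndex i) = weylGroup.ofIdx P i := by
  rw [negIndex, ← ofIdx_smul_index, ofIdx_smul, ofIdx_inv, ofIdx_mul_self, one_mul]

theorem reflectionPerm_negIndex (i j : ι) :
    P.reflectionPerm i (P.negIndex j) = P.negIndex (P.reflectionPerm i j) :=
  smul_negIndex (weylGroup.ofIdx P i) j

end WeylAction

section Pairing

variable {ι R M N : Type*} [Field R] [CharZero R] [AddCommGroup M] [Module R M]
  [AddCommGroup N] [Module R N] {P : RootPairing ι R M N} [P.IsCrystallographic]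

theorem pairingIn_smul_smul (w : P.weylGroup) (i j : ι) :
    P.pairingIn ℤ (w • i) (w • j) = P.pairingIn ℤ i j := by
  have refl : ∀ i j k : ι, P.pairingIn ℤ (P.reflectionPerm k i) (P.reflectionPerm k j) =
      P.pairingIn ℤ i j := fun i j k => by
    rw [← P.pairingIn_reflectionPerm, P.reflectionPerm_self]
  obtain ⟨w, hw⟩ := w
  induction hw using RootPairing.weylGroup.induction generalizing i j with
  | mem k => exact refl i j k
  | one => exact congrArg₂ _ (one_smul P.weylGroup i) (one_smul P.weylGroup j)
  | mul x y hx hy h1 h2 =>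
    change P.pairingIn ℤ ((⟨x, hx⟩ * ⟨y, hy⟩ : P.weylGroup) • i)
      ((⟨x, hx⟩ * ⟨y, hy⟩ : P.weylGroup) • j) = _
    rw [mul_smul, mul_smul, h1, h2]

theorem pairingIn_inv_smul (w : P.weylGroup) (i j : ι) :
    P.pairingIn ℤ i (w⁻¹ • j) = P.pairingIn ℤ (w • i) j := by
  rw [← pairingIn_smul_smul w, smul_inv_smul]

omit [CharZero R] in
theorem root_reflectionPerm_int (i j : ι) :
    P.root (P.reflectionPerm i j) = P.root j - P.pairingIn ℤ j i • P.root i := by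
  rw [root_reflectionPerm, P.reflection_apply_root' ℤ]

omit [CharZero R] in
theorem coroot_reflectionPerm_int (i j : ι) :
    P.coroot (P.reflectionPerm i j) = P.coroot j - P.pairingIn ℤ i j • P.coroot i := by
  rw [coroot_reflectionPerm, P.coreflection_apply_coroot, ← P.algebraMap_pairingIn ℤ i j,
    algebraMap_int_eq, eq_intCast, Int.cast_smul_eq_zsmul]

theorem pairingIn_negIndex_left (i j : ι) :
    P.pairingIn ℤ (P.negIndex i) j = -P.pairingIn ℤ i j := by
  simp [negIndex]

theorem pairingIn_negIndex_right (i j : ι) :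
    P.pairingIn ℤ i (P.negIndex j) = -P.pairingIn ℤ i j := by
  simp [negIndex]

theorem ne_negIndex (i : ι) : i ≠ P.negIndex i := by
  intro h
  have := pairingIn_negIndex_left (P := P) i i
  rw [← h, P.pairingIn_same] at this
  omega

end Pairing

namespace Base

section

variable {ι R M N : Type*} [Field R] [CharZero R] [AddCommGroup M] [Module R M]
  [AddCommGroup N] [Module R N] {P : RootPairing ι R M N} (b : P.Base)

/-- The coordinates of a root with respect to the simple roots. -/
noncomputable def rootCoords (i : ι) : b.support →₀ ℤ :=
  b.toWeightBasisInt.repr (P.rootSpanMem ℤ i)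

/-- The coordinates of a coroot with respect to the simple coroots. -/
noncomputable def corootCoords (i : ι) : b.support →₀ ℤ :=
  b.flip.toWeightBasisInt.repr (P.flip.rootSpanMem ℤ i)

theorem rootSpanMem_eq_sum_rootCoords (i : ι) :
    P.rootSpanMem ℤ i = ∑ j : b.support, b.rootCoords i j • P.rootSpanMem ℤ j := by
  have h := b.toWeightBasisInt.sum_repr (P.rootSpanMem ℤ i)
  rw [← h]
  refine Finset.sum_congr rfl fun j _ => ?_
  have : b.toWeightBasisInt j = P.rootSpanMem ℤ j := Subtype.ext (b.coe_toWeightBasisInt_apply j)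
  rw [this]; rfl

theorem root_eq_sum_rootCoords (i : ι) :
    P.root i = ∑ j : b.support, b.rootCoords i j • P.root j := by
  have := congrArg (Subtype.val) (b.rootSpanMem_eq_sum_rootCoords i)
  simpa using this

theorem rootCoords_eq_of_root_eq {i : ι} {f : b.support →₀ ℤ}
    (h : P.root i = ∑ j : b.support, f j • P.root j) : b.rootCoords i = f := by
  have hli := b.linearIndepOn_root.restrict_scalars' ℤ
  ext j
  refine Fintype.linearIndependent_iffₛ.mp hli (b.rootCoords i) f ?_ j
  convert! (b.root_eq_sum_rootCoords i).symm.trans h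

theorem corootCoords_eq_of_coroot_eq {i : ι} {f : b.support →₀ ℤ}
    (h : P.coroot i = ∑ j : b.support, f j • P.coroot j) : b.corootCoords i = f :=
  b.flip.rootCoords_eq_of_root_eq h

theorem coroot_eq_sum_corootCoords (i : ι) :
    P.coroot i = ∑ j : b.support, b.corootCoords i j • P.coroot j :=
  b.flip.root_eq_sum_rootCoords i

theorem rootCoords_injective : Function.Injective b.rootCoords := by
  intro i j h
  apply P.root.injective
  rw [b.root_eq_sum_rootCoords, b.root_eq_sum_rootCoords j, h]

theorem rootCoords_ne_zero (i : ι) : b.rootCoords i ≠ 0 := by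
  intro h
  apply P.ne_zero i
  rw [b.root_eq_sum_rootCoords, h]
  simp

theorem rootCoords_add {i j k : ι} (h : P.root k = P.root i + P.root j) :
    b.rootCoords k = b.rootCoords i + b.rootCoords j := by
  have : P.rootSpanMem ℤ k = P.rootSpanMem ℤ i + P.rootSpanMem ℤ j := Subtype.ext h
  rw [rootCoords, this, map_add]; rfl

theorem rootCoords_negIndex (i : ι) : b.rootCoords (P.negIndex i) = -b.rootCoords i := by
  have : P.rootSpanMem ℤ (P.negIndex i) = -P.rootSpanMem ℤ i := Subtype.ext (root_negIndex i)
  rw [rootCoords, this, map_neg]; rfl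

theorem rootCoords_reflectionPerm [P.IsCrystallographic] (i j : ι) :
    b.rootCoords (P.reflectionPerm i j) =
      b.rootCoords j - P.pairingIn ℤ j i • b.rootCoords i := by
  have : P.rootSpanMem ℤ (P.reflectionPerm i j) =
      P.rootSpanMem ℤ j - P.pairingIn ℤ j i • P.rootSpanMem ℤ i :=
    Subtype.ext (root_reflectionPerm_int i j)
  rw [rootCoords, this, map_sub, map_smul]; rfl

theorem corootCoords_negIndex (i : ι) : b.corootCoords (P.negIndex i) = -b.corootCoords i :=
  b.flip.rootCoords_negIndex i

theorem corootCoords_reflectionPerm [P.IsCrystallographic] (i j : ι) :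
    b.corootCoords (P.reflectionPerm i j) =
      b.corootCoords j - P.pairingIn ℤ i j • b.corootCoords i := by
  have : P.flip.rootSpanMem ℤ (P.reflectionPerm i j) =
      P.flip.rootSpanMem ℤ j - P.pairingIn ℤ i j • P.flip.rootSpanMem ℤ i :=
    Subtype.ext (coroot_reflectionPerm_int i j)
  rw [corootCoords, this, map_sub, map_smul]; rfl

theorem rootSpanMem_smul (w : P.weylGroup) (i : ι) :
    P.rootSpanMem ℤ (w • i) = ∑ j : b.support, b.rootCoords i j • P.rootSpanMem ℤ (w • (j : ι)) := by
  apply Subtype.ext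
  have h : w • P.root i = ∑ j : b.support, b.rootCoords i j • (w • P.root j) := by
    conv_lhs => rw [b.root_eq_sum_rootCoords i]
    rw [Finset.smul_sum]
    exact Finset.sum_congr rfl fun j _ => smul_comm _ _ _
  simpa [root_smul_index] using h

/-- The height of a coroot: the sum of its coordinates with respect to the simple coroots. -/
noncomputable def corootHt (i : ι) : ℤ := ∑ j : b.support, b.corootCoords i j

end

end Base
end RootPairing

/-! ### Positive roots and the length function -/

namespace RootPairing.Base

section Positivity

variable {ι R M N : Type*} [Field R] [CharZero R] [AddCommGroup M] [Module R M]
  [AddCommGroup N] [Module R N] {P : RootPairing ι R M N} (b : P.Base)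

open Classical in
/-- The indicator of the negative roots: `0` on positive roots, `1` on negative roots. -/
noncomputable def negInd (i : ι) : ℤ := if b.IsPos i then 0 else 1

variable {b} in
theorem negInd_of_isPos {i : ι} (h : b.IsPos i) : b.negInd i = 0 := if_pos h

variable {b} in
theorem negInd_of_not_isPos {i : ι} (h : ¬ b.IsPos i) : b.negInd i = 1 := if_neg h

theorem isPos_negIndex_iff (i : ι) : b.IsPos (P.negIndex i) ↔ ¬ b.IsPos i :=
  IsPos.neg_iff_not b i

theorem negInd_negIndex (i : ι) : b.negInd (P.negIndex i) = 1 - b.negInd i := by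
  by_cases h : b.IsPos i <;> simp [negInd, isPos_negIndex_iff, h]

variable {b} in
theorem IsPos.rootCoords_nonneg {i : ι} (hi : b.IsPos i) : 0 ≤ b.rootCoords i := by
  obtain ⟨f, -, h | h⟩ := b.exists_root_eq_sum_nat_or_neg i
  · have : b.rootCoords i = Finsupp.equivFunOnFinite.symm (fun j : b.support => (f j : ℤ)) := by
      apply b.rootCoords_eq_of_root_eq
      rw [h, ← Finset.sum_coe_sort]
      simp
    rw [this]
    intro j
    simp
  · exfalso
    have h' : P.root i = ∑ j ∈ b.support, (-(f j : ℤ)) • P.root j := by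
      rw [h]; simp
    rw [isPos_iff, height_eq_sum (f := fun j => -(f j : ℤ)) h', Finset.sum_neg_distrib] at hi
    have : (0 : ℤ) ≤ ∑ j ∈ b.support, (f j : ℤ) :=
      Finset.sum_nonneg fun j _ => Int.natCast_nonneg _
    omega

theorem isPos_iff_rootCoords_nonneg {i : ι} : b.IsPos i ↔ 0 ≤ b.rootCoords i := by
  refine ⟨IsPos.rootCoords_nonneg, fun h => ?_⟩
  by_contra hn
  have h' := IsPos.rootCoords_nonneg ((b.isPos_negIndex_iff i).2 hn)
  rw [rootCoords_negIndex] at h'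
  exact b.rootCoords_ne_zero i (le_antisymm (neg_nonneg.1 h') h)

theorem corootHt_reflectionPerm [P.IsCrystallographic] (i j : ι) :
    b.corootHt (P.reflectionPerm i j) =
      b.corootHt j - P.pairingIn ℤ i j * b.corootHt i := by
  simp [corootHt, corootCoords_reflectionPerm, Finset.mul_sum]

theorem corootCoords_simple (j : b.support) : b.corootCoords j = Finsupp.single j 1 := by
  classical
  apply b.corootCoords_eq_of_coroot_eq
  rw [Finset.sum_eq_single j] <;> simp +contextual [eq_comm]

theorem corootHt_simple {j : ι} (hj : j ∈ b.support) : b.corootHt j = 1 := by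
  classical
  rw [corootHt, b.corootCoords_simple ⟨j, hj⟩, Finset.sum_eq_single ⟨j, hj⟩] <;>
    simp +contextual [eq_comm]

variable [Finite ι] [P.IsCrystallographic] [P.IsReduced]

variable {b} in
theorem IsPos.corootCoords_eq {i : ι} (hi : b.IsPos i) :
    b.corootCoords i = (b.corootExponent i).mapRange (Nat.cast : ℕ → ℤ) Nat.cast_zero := by
  apply b.corootCoords_eq_of_coroot_eq
  rw [b.coroot_eq_sum_corootExponent hi]
  simp

variable {b} in
theorem IsPos.corootHt_eq {i : ι} (hi : b.IsPos i) : b.corootHt i = b.corootHeight i := by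
  simp [corootHt, corootHeight, hi.corootCoords_eq]

variable {b} in
theorem IsPos.corootCoords_nonneg {i : ι} (hi : b.IsPos i) : 0 ≤ b.corootCoords i := by
  rw [hi.corootCoords_eq]
  intro j
  simp

variable {b} in
theorem IsPos.one_le_corootHt {i : ι} (hi : b.IsPos i) : 1 ≤ b.corootHt i := by
  by_contra! h
  have h0 : ∑ j : b.support, b.corootCoords i j = 0 :=
    le_antisymm (by rw [corootHt] at h; omega)
      (Finset.sum_nonneg fun j _ => hi.corootCoords_nonneg j)
  rw [Finset.sum_eq_zero_iff_of_nonneg fun j _ => hi.corootCoords_nonneg j] at h0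
  apply P.ne_zero' i
  rw [b.coroot_eq_sum_corootCoords i]
  exact Finset.sum_eq_zero fun j hj => by rw [h0 j hj, zero_smul]

end Positivity

section Length

variable {ι R M N : Type*} [Field R] [CharZero R] [AddCommGroup M] [Module R M]
  [AddCommGroup N] [Module R N] {P : RootPairing ι R M N}
  [Finite ι] [P.IsCrystallographic] [P.IsReduced] (b : P.Base)

omit [Finite ι] [CharZero R] [P.IsCrystallographic] [P.IsReduced] in
theorem weylLength_prod_le (l : List b.support) :
    b.weylLength (l.map b.simpleReflection).prod ≤ l.length :=
  Nat.sInf_le ⟨l, rfl, rfl⟩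

theorem exists_reduced_word (w : P.weylGroup) :
    ∃ l : List b.support, l.length = b.weylLength w ∧ (l.map b.simpleReflection).prod = w := by
  obtain ⟨l, hl⟩ := b.exists_word w
  exact Nat.sInf_mem (s := {n | ∃ l : List b.support, l.length = n ∧
    (l.map b.simpleReflection).prod = w}) ⟨_, l, rfl, hl⟩

theorem weylLength_mul_simple_le (w : P.weylGroup) (j : b.support) :
    b.weylLength (w * weylGroup.ofIdx P j) ≤ b.weylLength w + 1 := by
  obtain ⟨l, hl, rfl⟩ := b.exists_reduced_word w
  rw [← hl]
  have := b.weylLength_prod_le (l ++ [j])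
  simpa [simpleReflection] using this

theorem weylLength_simple_mul_le (w : P.weylGroup) (j : b.support) :
    b.weylLength (weylGroup.ofIdx P j * w) ≤ b.weylLength w + 1 := by
  obtain ⟨l, hl, rfl⟩ := b.exists_reduced_word w
  rw [← hl]
  have := b.weylLength_prod_le (j :: l)
  simpa [simpleReflection] using this

variable {b} in
theorem IsPos.reflectionPerm_of_not {i j : ι} (hi : b.IsPos i) (hj : j ∈ b.support)
    (h : ¬ b.IsPos (P.reflectionPerm j i)) : i = j := by
  by_contra hij
  exact h (hi.reflectionPerm hj hij)

/-- The strong exchange condition: if the product of a word sends the positive root `γ` to a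
negative root, then multiplying by `s_γ` on the right amounts to deleting a letter. -/
theorem exists_word_mul_ofIdx (l : List b.support) {γ : ι} (hγ : b.IsPos γ)
    (h : ¬ b.IsPos ((l.map b.simpleReflection).prod • γ)) :
    ∃ l' : List b.support, l'.length + 1 = l.length ∧
      (l'.map b.simpleReflection).prod =
        (l.map b.simpleReflection).prod * weylGroup.ofIdx P γ := by
  induction l with
  | nil => exact absurd (by simpa using hγ) h
  | cons j l ih =>
    by_cases hl : b.IsPos ((l.map b.simpleReflection).prod • γ)
    · refine ⟨l, rfl, ?_⟩
      rw [List.map_cons, List.prod_cons, mul_smul] at h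
      have hj := hl.reflectionPerm_of_not j.2 h
      rw [List.map_cons, List.prod_cons, mul_assoc, mul_ofIdx, hj, simpleReflection,
        ofIdx_mul_ofIdx_mul]
    · obtain ⟨l', hl', hp⟩ := ih hl
      refine ⟨j :: l', by simp [hl'], ?_⟩
      rw [List.map_cons, List.prod_cons, List.map_cons, List.prod_cons, hp, mul_assoc]

theorem weylLength_mul_ofIdx_lt {u : P.weylGroup} {γ : ι} (hγ : b.IsPos γ)
    (h : ¬ b.IsPos (u • γ)) : b.weylLength (u * weylGroup.ofIdx P γ) < b.weylLength u := by
  obtain ⟨l, hl, rfl⟩ := b.exists_reduced_word u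
  obtain ⟨l', hl', hp⟩ := b.exists_word_mul_ofIdx l hγ h
  rw [← hp]
  have := b.weylLength_prod_le l'
  omega

omit [Finite ι] [CharZero R] [P.IsCrystallographic] [P.IsReduced] in
theorem mul_ofIdx_smul_self (u : P.weylGroup) (γ : ι) :
    (u * weylGroup.ofIdx P γ) • γ = P.negIndex (u • γ) := by
  rw [mul_smul, ← smul_negIndex]; rfl

theorem weylLength_lt_mul_ofIdx {u : P.weylGroup} {γ : ι} (hγ : b.IsPos γ)
    (h : b.IsPos (u • γ)) : b.weylLength u < b.weylLength (u * weylGroup.ofIdx P γ) := by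
  have := b.weylLength_mul_ofIdx_lt (u := u * weylGroup.ofIdx P γ) hγ
    (by rw [mul_ofIdx_smul_self, isPos_negIndex_iff]; exact not_not.2 h)
  rwa [mul_ofIdx_mul_ofIdx] at this

omit [Finite ι] [CharZero R] [P.IsCrystallographic] [P.IsReduced] in
theorem weylLength_one : b.weylLength 1 = 0 := by
  have := b.weylLength_prod_le []
  simpa using this

theorem weylLength_mul_simple (u : P.weylGroup) (j : b.support) :
    (b.weylLength (u * weylGroup.ofIdx P j) : ℤ) =
      b.weylLength u + 1 - 2 * b.negInd (u • (j : ι)) := by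
  have hj := isPos_of_mem_support j.2
  have h1 := b.weylLength_mul_simple_le u j
  have h2 := b.weylLength_mul_simple_le (u * weylGroup.ofIdx P j) j
  rw [mul_ofIdx_mul_ofIdx] at h2
  by_cases h : b.IsPos (u • (j : ι))
  · have := b.weylLength_lt_mul_ofIdx hj h
    rw [negInd_of_isPos h]; omega
  · have := b.weylLength_mul_ofIdx_lt hj h
    rw [negInd_of_not_isPos h]; omega

theorem weylLength_simple_mul (u : P.weylGroup) (j : b.support) :
    (b.weylLength (weylGroup.ofIdx P j * u) : ℤ) =
      b.weylLength u + 1 - 2 * b.negInd (u⁻¹ • (j : ι)) := by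
  have hj := isPos_of_mem_support j.2
  have h1 := b.weylLength_simple_mul_le u j
  have h2 := b.weylLength_simple_mul_le (weylGroup.ofIdx P j * u) j
  rw [ofIdx_mul_ofIdx_mul] at h2
  by_cases h : b.IsPos (u⁻¹ • (j : ι))
  · have := b.weylLength_lt_mul_ofIdx (u := u) h (by simpa using hj)
    rw [← ofIdx_mul] at this
    rw [negInd_of_isPos h]; omega
  · have h' := (b.isPos_negIndex_iff _).2 h
    have := b.weylLength_mul_ofIdx_lt (u := u) h' (by
      rw [← smul_negIndex, smul_inv_smul, isPos_negIndex_iff]; exact not_not.2 hj)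
    rw [ofIdx_negIndex, ← ofIdx_mul] at this
    rw [negInd_of_not_isPos h]; omega

/-- A reflection `s_γ` changes the length by at most `2|h_γ| - 1`. -/
theorem weylLength_le_mul_ofIdx {γ : ι} (hγ : b.IsPos γ) (u : P.weylGroup) :
    (b.weylLength u : ℤ) ≤ b.weylLength (u * weylGroup.ofIdx P γ) + 2 * b.corootHt γ - 1 := by
  obtain ⟨n, hn⟩ : ∃ n : ℕ, b.corootHt γ ≤ n := ⟨(b.corootHt γ).toNat, Int.self_le_toNat _⟩
  induction n generalizing γ u with
  | zero =>
    have := hγ.one_le_corootHt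
    simp only [Nat.cast_zero] at hn
    omega
  | succ n ih =>
    obtain ⟨j, hj, hp⟩ := hγ.exists_mem_support_pos_pairingIn
    rcases eq_or_ne γ j with rfl | hne
    · have h := b.weylLength_mul_simple_le (u * weylGroup.ofIdx P γ) ⟨γ, hj⟩
      rw [mul_ofIdx_mul_ofIdx] at h
      have := b.corootHt_simple hj
      omega
    · have hht := b.corootHt_reflectionPerm j γ
      rw [b.corootHt_simple hj] at hht
      have hi := ih (hγ.reflectionPerm hj hne) (u * weylGroup.ofIdx P j) (by push_cast at hn; omega)
      have hs : u * weylGroup.ofIdx P j * weylGroup.ofIdx P (P.reflectionPerm j γ) =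
          u * weylGroup.ofIdx P γ * weylGroup.ofIdx P j := by
        rw [mul_assoc, mul_assoc, mul_ofIdx (weylGroup.ofIdx P j), ofIdx_smul_index,
          P.reflectionPerm_self]
      rw [hs] at hi
      have h1 := b.weylLength_mul_simple_le (u * weylGroup.ofIdx P j) ⟨j, hj⟩
      have h2 := b.weylLength_mul_simple_le (u * weylGroup.ofIdx P γ) ⟨j, hj⟩
      rw [mul_ofIdx_mul_ofIdx] at h1
      simp only at h1 h2
      omega

end Length

end RootPairing.Base

/-! ### Affine simple roots and inversions -/

namespace RootPairing.Base

section AffineSimple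

variable {ι R M N : Type*} [Field R] [CharZero R] [AddCommGroup M] [Module R M]
  [AddCommGroup N] [Module R N] {P : RootPairing ι R M N}
  [Finite ι] [P.IsCrystallographic] [P.IsReduced] (b : P.Base)

open Classical in
/-- A root `α` is *affine simple* if it is the finite part of a simple root of the affine root
system. With `ε` equal to `0` or `1` according to the sign of `α`, this is expressed by saying
that the affine reflection in `α + εδ` changes the sign of no affine root other than `±(α + εδ)`;
the identity below spells this out in terms of the indicator of the negative roots. -/
def IsAffineSimple (a : ι) : Prop :=
  ∀ i, b.negInd (P.reflectionPerm a i) = b.negInd i - b.negInd a * P.pairingIn ℤ i a +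
    (if i = a then 1 else 0) - (if i = P.negIndex a then 1 else 0)

variable {b} in
omit [Finite ι] [P.IsReduced] in
theorem isAffineSimple_of_forall_isPos {a : ι}
    (h : ∀ i, b.IsPos i → i ≠ a → i ≠ P.negIndex a → b.negInd (P.reflectionPerm a i) =
      - b.negInd a * P.pairingIn ℤ i a) : b.IsAffineSimple a := by
  intro i
  by_cases h1 : i = a
  · subst h1
    rw [if_pos rfl, if_neg (ne_negIndex i), P.pairingIn_same,
      show P.reflectionPerm i i = P.negIndex i from rfl, negInd_negIndex]
    ring
  by_cases h2 : i = P.negIndex a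
  · subst h2
    rw [if_pos rfl, if_neg h1, pairingIn_negIndex_left, P.pairingIn_same, reflectionPerm_negIndex,
      show P.reflectionPerm a a = P.negIndex a from rfl, negIndex_negIndex, negInd_negIndex]
    ring
  rw [if_neg h1, if_neg h2]
  by_cases hi : b.IsPos i
  · rw [h i hi h1 h2, negInd_of_isPos hi]; ring
  · have h3 := h (P.negIndex i) ((b.isPos_negIndex_iff i).2 hi)
      (fun h => h2 (negIndex_eq_iff.1 h)) (fun h => h1 (by
        rw [negIndex_eq_iff, negIndex_negIndex] at h; exact h))
    rw [reflectionPerm_negIndex, negInd_negIndex, pairingIn_negIndex_left] at h3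
    rw [negInd_of_not_isPos hi]
    linarith

theorem isAffineSimple_of_mem_support {a : ι} (ha : a ∈ b.support) : b.IsAffineSimple a :=
  isAffineSimple_of_forall_isPos fun i hi h1 _ => by
    rw [negInd_of_isPos (hi.reflectionPerm ha h1), negInd_of_isPos (isPos_of_mem_support ha)]
    simp

omit [P.IsReduced] in
/-- The negative of a maximal positive root is affine simple. -/
theorem isAffineSimple_negIndex_of_maximal {θ : ι} (hθ : b.IsPos θ)
    (hmax : ∀ i, b.rootCoords θ ≤ b.rootCoords i → i = θ) :
    b.IsAffineSimple (P.negIndex θ) := by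
  -- no root exceeds the maximal root `θ` by a positive root
  have key : ∀ i j : ι, b.IsPos j → ∀ k : ℕ,
      b.rootCoords i ≠ b.rootCoords θ + k • b.rootCoords θ + b.rootCoords j := by
    intro i j hj k hij
    have hle : b.rootCoords θ ≤ b.rootCoords i := by
      rw [hij, add_assoc]
      exact le_add_of_nonneg_right
        (add_nonneg (nsmul_nonneg hθ.rootCoords_nonneg k) hj.rootCoords_nonneg)
    have h0 : k • b.rootCoords θ + b.rootCoords j = 0 := by
      rw [hmax i hle, add_assoc] at hij
      exact left_eq_add.1 hij
    exact b.rootCoords_ne_zero j (le_antisymm (by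
      rw [← h0]; exact le_add_of_nonneg_left (nsmul_nonneg hθ.rootCoords_nonneg k))
      hj.rootCoords_nonneg)
  refine isAffineSimple_of_forall_isPos fun i hi h1 h2 => ?_
  rw [negIndex_negIndex] at h2
  have hrefl : P.reflectionPerm (P.negIndex θ) i = P.reflectionPerm θ i := by
    rw [← ofIdx_smul_index, ofIdx_negIndex, ofIdx_smul_index]
  rw [hrefl, negInd_negIndex, negInd_of_isPos hθ, pairingIn_negIndex_right]
  rcases lt_trichotomy (P.pairingIn ℤ i θ) 0 with hp | hp | hp
  · exfalso
    obtain ⟨k, hk⟩ := P.root_add_root_mem_of_pairingIn_neg hp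
      (fun h => h1 (P.root.injective (by rw [h, root_negIndex])))
    refine key k i hi 0 ?_
    rw [b.rootCoords_add hk]
    simp [add_comm]
  · have : P.reflectionPerm θ i = i := P.root.injective (by
      rw [root_reflectionPerm_int, hp]; simp)
    rw [this, hp, negInd_of_isPos hi]; simp
  · obtain ⟨k, hk⟩ := P.root_sub_root_mem_of_pairingIn_pos hp h2
    have hik : b.rootCoords i = b.rootCoords θ + b.rootCoords k :=
      b.rootCoords_add (by rw [hk]; abel)
    have hkn : ¬ b.IsPos k := fun h => key i k h 0 (by rw [hik]; simp)
    have hkp := (b.isPos_negIndex_iff k).2 hkn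
    have hle : P.pairingIn ℤ i θ ≤ 1 := by
      by_contra! hgt
      obtain ⟨n, hn⟩ := Int.eq_ofNat_of_zero_le (sub_nonneg.2 (show 2 ≤ P.pairingIn ℤ i θ from hgt))
      refine key (P.negIndex (P.reflectionPerm θ i)) _ hkp n ?_
      rw [rootCoords_negIndex, rootCoords_reflectionPerm, rootCoords_negIndex, hik,
        sub_eq_iff_eq_add.1 hn, ← natCast_zsmul]
      module
    have h1' : P.pairingIn ℤ i θ = 1 := by omega
    have hrk : P.reflectionPerm θ i = k := P.root.injective (by
      rw [root_reflectionPerm_int, h1', hk, one_smul])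
    rw [hrk, negInd_of_not_isPos hkn, h1']
    simp

omit [P.IsReduced] in
/-- Every root lies below some maximal root `θ` with `-θ` affine simple. -/
theorem exists_maximal_root (i : ι) (hi : b.IsPos i) :
    ∃ θ, b.IsPos θ ∧ b.IsAffineSimple (P.negIndex θ) ∧ b.rootCoords i ≤ b.rootCoords θ := by
  obtain ⟨_, hle, ⟨θ, rfl⟩, hmax⟩ :=
    (Set.finite_range b.rootCoords).exists_le_maximal ⟨i, rfl⟩
  have hθ : b.IsPos θ := b.isPos_iff_rootCoords_nonneg.2 (hi.rootCoords_nonneg.trans hle)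
  refine ⟨θ, hθ, b.isAffineSimple_negIndex_of_maximal hθ fun j hj => ?_, hle⟩
  exact b.rootCoords_injective (le_antisymm (hmax ⟨j, rfl⟩ hj) hj)

end AffineSimple

section Inversions

variable {ι R M N : Type*} [Field R] [CharZero R] [AddCommGroup M] [Module R M]
  [AddCommGroup N] [Module R N] {P : RootPairing ι R M N}
  [Finite ι] (b : P.Base)

/-- The finite set of positive roots. -/
noncomputable def posRoots : Finset ι := (Set.toFinite {i | b.IsPos i}).toFinset

variable {b} in
theorem mem_posRoots {i : ι} : i ∈ b.posRoots ↔ b.IsPos i := by simp [posRoots]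

/-- The number of inversions of a Weyl group element: the number of positive roots that it sends
to negative roots. -/
noncomputable def numInversions (w : P.weylGroup) : ℤ := ∑ i ∈ b.posRoots, b.negInd (w • i)

omit [Finite ι] in
theorem pairingIn_eq_sum_corootCoords [P.IsCrystallographic] (i k : ι) :
    P.pairingIn ℤ i k = ∑ j : b.support, b.corootCoords k j * P.pairingIn ℤ i j := by
  apply FaithfulSMul.algebraMap_injective ℤ R
  simp_rw [map_sum, map_mul, P.algebraMap_pairingIn, ← P.root_coroot_eq_pairing]
  conv_lhs => rw [b.coroot_eq_sum_corootCoords k]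
  simp

variable [P.IsCrystallographic] [P.IsReduced]

/-- The sum of the positive roots pairs with each simple coroot to `2`. -/
theorem sum_pairingIn_simple {j : ι} (hj : j ∈ b.support) :
    ∑ i ∈ b.posRoots, P.pairingIn ℤ i j = 2 := by
  classical
  rw [← Finset.add_sum_erase _ _ (mem_posRoots.2 (isPos_of_mem_support hj)), P.pairingIn_same]
  have hneg : ∀ i, P.pairingIn ℤ (P.reflectionPerm j i) j = - P.pairingIn ℤ i j := fun i => by
    rw [← P.pairingIn_reflectionPerm, P.pairingIn_reflectionPerm_self_right]
  rw [Finset.sum_involution (fun i _ => P.reflectionPerm j i)]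
  · rfl
  · intro i _
    rw [hneg]; ring
  · intro i _ h0 h
    have := hneg i
    rw [h] at this
    omega
  · intro i hi
    rw [Finset.mem_erase, mem_posRoots] at hi ⊢
    refine ⟨fun h => ?_, hi.2.reflectionPerm hj hi.1⟩
    have h' : i = P.negIndex j := by rw [← P.reflectionPerm_self j i, h]; rfl
    exact (b.isPos_negIndex_iff j).1 (h' ▸ hi.2) (isPos_of_mem_support hj)
  · intro i _
    exact P.reflectionPerm_self j i

theorem sum_pairingIn_posRoots (k : ι) :
    ∑ i ∈ b.posRoots, P.pairingIn ℤ i k = 2 * b.corootHt k := by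
  simp_rw [b.pairingIn_eq_sum_corootCoords _ k]
  rw [Finset.sum_comm]
  simp_rw [← Finset.mul_sum, fun j : b.support => b.sum_pairingIn_simple j.2]
  rw [← Finset.sum_mul, mul_comm]; rfl

variable {b} in
theorem IsAffineSimple.numInversions_mul {a : ι} (ha : b.IsAffineSimple a) (u : P.weylGroup) :
    b.numInversions (weylGroup.ofIdx P a * u) = b.numInversions u + 1 -
      2 * b.negInd (u⁻¹ • a) - 2 * (b.negInd a * b.corootHt (u⁻¹ • a)) := by
  classical
  have h1 : ∀ i, b.negInd ((weylGroup.ofIdx P a * u) • i) = b.negInd (u • i) -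
      b.negInd a * P.pairingIn ℤ i (u⁻¹ • a) + (if i = u⁻¹ • a then 1 else 0) -
      (if i = P.negIndex (u⁻¹ • a) then 1 else 0) := by
    intro i
    rw [mul_smul, ofIdx_smul_index, ha (u • i), pairingIn_inv_smul, ← smul_negIndex]
    simp only [eq_inv_smul_iff]
  simp_rw [numInversions, h1, Finset.sum_sub_distrib, Finset.sum_add_distrib,
    Finset.sum_sub_distrib, ← Finset.mul_sum, sum_pairingIn_posRoots, Finset.sum_ite_eq',
    mem_posRoots, isPos_negIndex_iff]
  by_cases h : b.IsPos (u⁻¹ • a) <;> simp [h, negInd] <;> ring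

theorem weylLength_eq_numInversions (w : P.weylGroup) :
    (b.weylLength w : ℤ) = b.numInversions w := by
  obtain ⟨l, rfl⟩ := b.exists_word w
  induction l with
  | nil =>
    rw [List.map_nil, List.prod_nil, b.weylLength_one, numInversions]
    refine (Finset.sum_eq_zero fun i hi => ?_).symm
    rw [one_smul, negInd_of_isPos (mem_posRoots.1 hi)]
  | cons j l ih =>
    rw [List.map_cons, List.prod_cons, simpleReflection, weylLength_simple_mul, ih,
      (b.isAffineSimple_of_mem_support j.2).numInversions_mul,
      negInd_of_isPos (isPos_of_mem_support j.2)]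
    ring

variable {b} in
/-- The effect on the length of multiplying on the left by the reflection in an affine simple
root. -/
theorem IsAffineSimple.weylLength_mul {a : ι} (ha : b.IsAffineSimple a) (u : P.weylGroup) :
    (b.weylLength (weylGroup.ofIdx P a * u) : ℤ) = b.weylLength u + 1 -
      2 * b.negInd (u⁻¹ • a) - 2 * (b.negInd a * b.corootHt (u⁻¹ • a)) := by
  rw [weylLength_eq_numInversions, weylLength_eq_numInversions, ha.numInversions_mul]

end Inversions

end RootPairing.Base

/-! ### Paths and left multiplication by affine simple reflections -/

namespace RootPairing.Base

section Paths

variable {ι R M N : Type*} [Field R] [CharZero R] [AddCommGroup M] [Module R M]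
  [AddCommGroup N] [Module R N] {P : RootPairing ι R M N} (b : P.Base)

/-- The positive root `γ` labels an edge `u ⟶ u s_γ` of the quantum Bruhat graph. As the length
increases exactly when `u γ` is positive, the two kinds of edges are described by one equation. -/
def IsStep (u : P.weylGroup) (γ : ι) : Prop :=
  b.IsPos γ ∧ (b.weylLength (u * weylGroup.ofIdx P γ) : ℤ) =
    b.weylLength u + 1 - 2 * (b.negInd (u • γ) * b.corootHt γ)

/-- The exponent of the weight of the edge `u ⟶ u s_γ`. -/
noncomputable def stepWeight (u : P.weylGroup) (γ : ι) : b.support →₀ ℤ :=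
  b.negInd (u • γ) • b.corootCoords γ

variable {b} in
theorem stepWeight_of_isPos {u : P.weylGroup} {γ : ι} (h : b.IsPos (u • γ)) :
    b.stepWeight u γ = 0 := by
  rw [stepWeight, negInd_of_isPos h, zero_smul]

variable {b} in
theorem stepWeight_of_not_isPos {u : P.weylGroup} {γ : ι} (h : ¬ b.IsPos (u • γ)) :
    b.stepWeight u γ = b.corootCoords γ := by
  rw [stepWeight, negInd_of_not_isPos h, one_smul]

/-- There is a directed path from `u` to `v` in the quantum Bruhat graph whose weight has exponent
`d`. -/
inductive HasPath (u : P.weylGroup) : P.weylGroup → (b.support →₀ ℤ) → Prop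
  | refl : HasPath u u 0
  | tail {v : P.weylGroup} {d : b.support →₀ ℤ} {γ : ι} (h : HasPath u v d)
      (hs : b.IsStep v γ) : HasPath u (v * weylGroup.ofIdx P γ) (d + b.stepWeight v γ)

variable {b}

theorem HasPath.cast {u v v' : P.weylGroup} {d d' : b.support →₀ ℤ} (h : b.HasPath u v d)
    (hv : v = v') (hd : d = d') : b.HasPath u v' d' := hv ▸ hd ▸ h

theorem IsStep.hasPath {u : P.weylGroup} {γ : ι} (h : b.IsStep u γ) :
    b.HasPath u (u * weylGroup.ofIdx P γ) (b.stepWeight u γ) :=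
  (HasPath.refl.tail h).cast rfl (zero_add _)

theorem HasPath.trans {u v w : P.weylGroup} {d e : b.support →₀ ℤ} (h₁ : b.HasPath u v d)
    (h₂ : b.HasPath v w e) : b.HasPath u w (d + e) := by
  induction h₂ with
  | refl => exact h₁.cast rfl (add_zero d).symm
  | tail _ hs ih => exact (ih.tail hs).cast rfl (add_assoc _ _ _)

/-- The number of edges of a path is determined by its end points and its weight; in particular
this number is nonnegative. -/
theorem HasPath.length_nonneg {u v : P.weylGroup} {d : b.support →₀ ℤ} (h : b.HasPath u v d) :
    0 ≤ (b.weylLength v : ℤ) - b.weylLength u + 2 * ∑ j, d j := by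
  induction h with
  | refl => simp
  | @tail v d γ _ hs ih =>
    have : ∑ j, (d + b.stepWeight v γ) j = ∑ j, d j + b.negInd (v • γ) * b.corootHt γ := by
      simp [stepWeight, Finset.sum_add_distrib, corootHt, Finset.mul_sum]
    rw [this, hs.2]
    linarith

variable (b) in
/-- The exponent of the weight of an edge `x ⟶ s_a x`, for `a` affine simple. It is used for all
`x`, the values at `x` and `s_a x` being opposite. -/
noncomputable def affineShift (a : ι) (x : P.weylGroup) : b.support →₀ ℤ :=
  b.negInd a • b.corootCoords (x⁻¹ • a)

omit [CharZero R] in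
theorem ofIdx_mul_inv_smul (a : ι) (x : P.weylGroup) :
    (weylGroup.ofIdx P a * x)⁻¹ • a = P.negIndex (x⁻¹ • a) := by
  rw [mul_inv_rev, ofIdx_inv, mul_smul, ← smul_negIndex]; rfl

theorem affineShift_ofIdx_mul (a : ι) (x : P.weylGroup) :
    b.affineShift a (weylGroup.ofIdx P a * x) = -b.affineShift a x := by
  rw [affineShift, ofIdx_mul_inv_smul, corootCoords_negIndex, smul_neg, affineShift]

theorem sum_affineShift (a : ι) (x : P.weylGroup) :
    ∑ j, b.affineShift a x j = b.negInd a * b.corootHt (x⁻¹ • a) := by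
  simp [affineShift, corootHt, Finset.mul_sum]

variable [Finite ι] [P.IsCrystallographic] [P.IsReduced]

/-- Left multiplication by the reflection in an affine simple root `a` is an edge whenever
`x⁻¹ a` is positive. -/
theorem IsAffineSimple.hasPath_ofIdx_mul {a : ι} (ha : b.IsAffineSimple a) {x : P.weylGroup}
    (hx : b.IsPos (x⁻¹ • a)) :
    b.HasPath x (weylGroup.ofIdx P a * x) (b.affineShift a x) := by
  have hs : b.IsStep x (x⁻¹ • a) := by
    refine ⟨hx, ?_⟩
    rw [← ofIdx_mul, ha.weylLength_mul, smul_inv_smul, negInd_of_isPos hx]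
    ring
  refine hs.hasPath.cast (ofIdx_mul x a).symm ?_
  rw [stepWeight, smul_inv_smul]; rfl

omit [Finite ι] [P.IsReduced] in
theorem IsAffineSimple.negInd_ofIdx_mul_smul {a γ : ι} (ha : b.IsAffineSimple a)
    {u : P.weylGroup} (h1 : γ ≠ u⁻¹ • a) (h2 : γ ≠ P.negIndex (u⁻¹ • a)) :
    b.negInd ((weylGroup.ofIdx P a * u) • γ) =
      b.negInd (u • γ) - b.negInd a * P.pairingIn ℤ γ (u⁻¹ • a) := by
  rw [mul_smul, ofIdx_smul_index, ha, pairingIn_inv_smul, if_neg, if_neg]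
  · ring
  · rwa [← eq_inv_smul_iff, smul_negIndex]
  · rwa [← eq_inv_smul_iff]

omit [CharZero R] [Finite ι] [P.IsCrystallographic] [P.IsReduced] in
theorem mul_ofIdx_inv_smul (u : P.weylGroup) (γ a : ι) :
    (u * weylGroup.ofIdx P γ)⁻¹ • a = P.reflectionPerm γ (u⁻¹ • a) := by
  rw [mul_inv_rev, ofIdx_inv, mul_smul]; rfl

/-- If `a` is affine simple, and `u⁻¹ a` and `v⁻¹ a` have the same sign for `v = u s_γ`, then an edge
`u ⟶ v` gives an edge `s_a u ⟶ s_a v`. -/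
theorem IsAffineSimple.hasPath_of_isStep {a γ : ι} (ha : b.IsAffineSimple a) {u : P.weylGroup}
    (hs : b.IsStep u γ)
    (h : b.IsPos (u⁻¹ • a) ↔ b.IsPos ((u * weylGroup.ofIdx P γ)⁻¹ • a)) :
    b.HasPath (weylGroup.ofIdx P a * u) (weylGroup.ofIdx P a * (u * weylGroup.ofIdx P γ))
      (b.stepWeight u γ + b.affineShift a (u * weylGroup.ofIdx P γ) - b.affineShift a u) := by
  have hv := ha.weylLength_mul (u * weylGroup.ofIdx P γ)
  have hu := ha.weylLength_mul u
  have hneg : b.negInd ((u * weylGroup.ofIdx P γ)⁻¹ • a) = b.negInd (u⁻¹ • a) := by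
    by_cases h' : b.IsPos (u⁻¹ • a)
    · rw [negInd_of_isPos h', negInd_of_isPos (h.1 h')]
    · rw [negInd_of_not_isPos h', negInd_of_not_isPos (h'.imp h.2)]
  rw [hneg, mul_ofIdx_inv_smul, corootHt_reflectionPerm, hs.2] at hv
  rw [mul_ofIdx_inv_smul] at h
  have hn := ha.negInd_ofIdx_mul_smul (u := u) (γ := γ)
    (by
      intro hγ
      rw [← hγ] at h
      exact (b.isPos_negIndex_iff γ).1 (h.1 hs.1) hs.1)
    (by
      intro hγ
      rw [← negIndex_eq_iff] at hγ
      rw [← hγ, reflectionPerm_negIndex] at h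
      change _ ↔ b.IsPos (P.negIndex (P.negIndex γ)) at h
      rw [negIndex_negIndex] at h
      exact (b.isPos_negIndex_iff γ).1 (h.2 hs.1) hs.1)
  have hs' : b.IsStep (weylGroup.ofIdx P a * u) γ := by
    refine ⟨hs.1, ?_⟩
    rw [mul_assoc, hv, hu, hn]
    ring
  refine hs'.hasPath.cast (mul_assoc _ _ _) ?_
  rw [stepWeight, hn, stepWeight, affineShift, affineShift, mul_ofIdx_inv_smul,
    corootCoords_reflectionPerm]
  module

/-- If `a` is affine simple and an edge `u ⟶ u s_γ` leads from an element with `u⁻¹ a` positive to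
one with `(u s_γ)⁻¹ a` negative, then it is the edge `u ⟶ s_a u`. -/
theorem IsAffineSimple.eq_of_isStep {a γ : ι} (ha : b.IsAffineSimple a) {u : P.weylGroup}
    (hs : b.IsStep u γ) (h1 : b.IsPos (u⁻¹ • a))
    (h2 : ¬ b.IsPos ((u * weylGroup.ofIdx P γ)⁻¹ • a)) : γ = u⁻¹ • a := by
  by_contra hne
  have hn := ha.negInd_ofIdx_mul_smul hne (by
    intro hγ
    rw [← negIndex_eq_iff] at hγ
    rw [← hγ] at h1
    exact (b.isPos_negIndex_iff γ).1 h1 hs.1)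
  have hv := ha.weylLength_mul (u * weylGroup.ofIdx P γ)
  have hu := ha.weylLength_mul u
  rw [negInd_of_not_isPos h2, mul_ofIdx_inv_smul, corootHt_reflectionPerm, hs.2] at hv
  rw [negInd_of_isPos h1] at hu
  -- the length would change by `-1` along an ascent, or by more than a reflection can
  have hdiff : (b.weylLength (weylGroup.ofIdx P a * u * weylGroup.ofIdx P γ) : ℤ) =
      b.weylLength (weylGroup.ofIdx P a * u) - 1 -
        2 * (b.negInd ((weylGroup.ofIdx P a * u) • γ) * b.corootHt γ) := by
    rw [mul_assoc, hv, hu, hn]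
    ring
  by_cases hp : b.IsPos ((weylGroup.ofIdx P a * u) • γ)
  · have := b.weylLength_lt_mul_ofIdx hs.1 hp
    rw [negInd_of_isPos hp] at hdiff
    omega
  · have := b.weylLength_le_mul_ofIdx hs.1 (weylGroup.ofIdx P a * u)
    rw [negInd_of_not_isPos hp] at hdiff
    omega

variable (b)

open Classical in
/-- The element of `{x, s_a x}` from which the edge between them starts. -/
noncomputable def lowerRep (a : ι) (x : P.weylGroup) : P.weylGroup :=
  if b.IsPos (x⁻¹ • a) then x else weylGroup.ofIdx P a * x

open Classical in
/-- The exponent of the weight of the path of length at most one from `lowerRep a x` to `x`. -/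
noncomputable def lowerWeight (a : ι) (x : P.weylGroup) : b.support →₀ ℤ :=
  if b.IsPos (x⁻¹ • a) then 0 else -b.affineShift a x

open Classical in
/-- The element of `{x, s_a x}` at which the edge between them ends. -/
noncomputable def upperRep (a : ι) (x : P.weylGroup) : P.weylGroup :=
  if b.IsPos (x⁻¹ • a) then weylGroup.ofIdx P a * x else x

open Classical in
/-- The exponent of the weight of the path of length at most one from `x` to `upperRep a x`. -/
noncomputable def upperWeight (a : ι) (x : P.weylGroup) : b.support →₀ ℤ :=
  if b.IsPos (x⁻¹ • a) then b.affineShift a x else 0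

variable {b}

theorem IsAffineSimple.hasPath_of_not {a : ι} (ha : b.IsAffineSimple a) {x : P.weylGroup}
    (hx : ¬ b.IsPos (x⁻¹ • a)) :
    b.HasPath (weylGroup.ofIdx P a * x) x (-b.affineShift a x) := by
  have h : b.IsPos ((weylGroup.ofIdx P a * x)⁻¹ • a) := by
    rwa [ofIdx_mul_inv_smul, isPos_negIndex_iff]
  exact (ha.hasPath_ofIdx_mul h).cast (ofIdx_mul_ofIdx_mul a x) (affineShift_ofIdx_mul a x)

theorem IsAffineSimple.stepWeight_eq {a γ : ι} (ha : b.IsAffineSimple a) {u : P.weylGroup}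
    (hs : b.IsStep u γ) (h1 : b.IsPos (u⁻¹ • a))
    (h2 : ¬ b.IsPos ((u * weylGroup.ofIdx P γ)⁻¹ • a)) :
    u * weylGroup.ofIdx P γ = weylGroup.ofIdx P a * u ∧ b.stepWeight u γ = b.affineShift a u := by
  obtain rfl := ha.eq_of_isStep hs h1 h2
  refine ⟨(ofIdx_mul u a).symm, ?_⟩
  rw [stepWeight, smul_inv_smul]; rfl

theorem IsAffineSimple.hasPath_lowerRep_step {a γ : ι} (ha : b.IsAffineSimple a)
    {u : P.weylGroup} (hs : b.IsStep u γ) :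
    b.HasPath (b.lowerRep a u) (b.lowerRep a (u * weylGroup.ofIdx P γ))
      (b.lowerWeight a u + b.stepWeight u γ - b.lowerWeight a (u * weylGroup.ofIdx P γ)) := by
  by_cases h1 : b.IsPos (u⁻¹ • a) <;>
    by_cases h2 : b.IsPos ((u * weylGroup.ofIdx P γ)⁻¹ • a) <;>
    simp only [lowerRep, lowerWeight, h1, h2, if_true, if_false]
  · exact hs.hasPath.cast rfl (by abel)
  · obtain ⟨h3, h4⟩ := ha.stepWeight_eq hs h1 h2
    rw [h3, h4, ofIdx_mul_ofIdx_mul, affineShift_ofIdx_mul]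
    exact HasPath.refl.cast rfl (by abel)
  · exact ((ha.hasPath_of_not h1).trans hs.hasPath).cast rfl (by abel)
  · exact (ha.hasPath_of_isStep hs (by tauto)).cast rfl (by abel)

theorem IsAffineSimple.hasPath_upperRep_step {a γ : ι} (ha : b.IsAffineSimple a)
    {u : P.weylGroup} (hs : b.IsStep u γ) :
    b.HasPath (b.upperRep a u) (b.upperRep a (u * weylGroup.ofIdx P γ))
      (b.stepWeight u γ + b.upperWeight a (u * weylGroup.ofIdx P γ) - b.upperWeight a u) := by
  by_cases h1 : b.IsPos (u⁻¹ • a) <;>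
    by_cases h2 : b.IsPos ((u * weylGroup.ofIdx P γ)⁻¹ • a) <;>
    simp only [upperRep, upperWeight, h1, h2, if_true, if_false]
  · exact ha.hasPath_of_isStep hs (by tauto)
  · obtain ⟨h3, h4⟩ := ha.stepWeight_eq hs h1 h2
    rw [h3, h4]
    exact HasPath.refl.cast rfl (by abel)
  · exact (hs.hasPath.trans (ha.hasPath_ofIdx_mul h2)).cast rfl (by abel)
  · exact hs.hasPath.cast rfl (by abel)

theorem IsAffineSimple.hasPath_lowerRep {a : ι} (ha : b.IsAffineSimple a) {u v : P.weylGroup}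
    {d : b.support →₀ ℤ} (h : b.HasPath u v d) :
    b.HasPath (b.lowerRep a u) (b.lowerRep a v) (b.lowerWeight a u + d - b.lowerWeight a v) := by
  induction h with
  | refl => exact HasPath.refl.cast rfl (by abel)
  | tail _ hs ih => exact (ih.trans (ha.hasPath_lowerRep_step hs)).cast rfl (by abel)

theorem IsAffineSimple.hasPath_upperRep {a : ι} (ha : b.IsAffineSimple a) {u v : P.weylGroup}
    {d : b.support →₀ ℤ} (h : b.HasPath u v d) :
    b.HasPath (b.upperRep a u) (b.upperRep a v) (d + b.upperWeight a v - b.upperWeight a u) := by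
  induction h with
  | refl => exact HasPath.refl.cast rfl (by abel)
  | tail _ hs ih => exact (ih.trans (ha.hasPath_upperRep_step hs)).cast rfl (by abel)

theorem exists_hasPath (u v : P.weylGroup) : ∃ d, b.HasPath u v d := by
  obtain ⟨l, hl⟩ := b.exists_word (u⁻¹ * v)
  obtain rfl : v = u * (l.map b.simpleReflection).prod := by rw [hl, mul_inv_cancel_left]
  clear hl
  induction l using List.reverseRecOn with
  | nil => exact ⟨0, HasPath.refl.cast (by simp) rfl⟩
  | append_singleton l j ih =>
    obtain ⟨d, hd⟩ := ih
    have hs : b.IsStep (u * (l.map b.simpleReflection).prod) j :=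
      ⟨isPos_of_mem_support j.2, by rw [weylLength_mul_simple, b.corootHt_simple j.2, mul_one]⟩
    exact ⟨_, (hd.tail hs).cast (by simp [mul_assoc, simpleReflection]) rfl⟩

end Paths

section Least

variable {ι R M N : Type*} [Field R] [CharZero R] [AddCommGroup M] [Module R M]
  [AddCommGroup N] [Module R N] {P : RootPairing ι R M N} (b : P.Base)

/-- Among the weights of the paths from `u` to `v` there is one that divides all others. -/
def HasLeastWeight (u v : P.weylGroup) : Prop :=
  ∃ d, b.HasPath u v d ∧ ∀ e, b.HasPath u v e → d ≤ e

variable {b} [Finite ι] [P.IsCrystallographic] [P.IsReduced]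

theorem IsAffineSimple.hasPath_of_isPos_of_not {a : ι} (ha : b.IsAffineSimple a)
    {u v : P.weylGroup} (hu : b.IsPos (u⁻¹ • a)) (hv : ¬ b.IsPos (v⁻¹ • a))
    {d : b.support →₀ ℤ} (h : b.HasPath u v d) :
    b.HasPath u (weylGroup.ofIdx P a * v) (d + b.affineShift a v) := by
  have := ha.hasPath_lowerRep h
  simp only [lowerRep, lowerWeight, hu, hv, if_true, if_false] at this
  exact this.cast rfl (by abel)

theorem IsAffineSimple.hasLeastWeight_of_isPos_of_not {a : ι} (ha : b.IsAffineSimple a)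
    {u v : P.weylGroup} (hu : b.IsPos (u⁻¹ • a)) (hv : ¬ b.IsPos (v⁻¹ • a))
    (h : b.HasLeastWeight u (weylGroup.ofIdx P a * v)) : b.HasLeastWeight u v := by
  obtain ⟨d, hd, hmin⟩ := h
  refine ⟨d - b.affineShift a v, (hd.trans (ha.hasPath_of_not hv)).cast rfl (by abel),
    fun e he => ?_⟩
  rw [sub_le_iff_le_add]
  exact hmin _ (ha.hasPath_of_isPos_of_not hu hv he)

theorem IsAffineSimple.hasPath_of_not_of_not {a : ι} (ha : b.IsAffineSimple a)
    {u v : P.weylGroup} (hu : ¬ b.IsPos (u⁻¹ • a)) (hv : ¬ b.IsPos (v⁻¹ • a))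
    {d : b.support →₀ ℤ} (h : b.HasPath u v d) :
    b.HasPath (weylGroup.ofIdx P a * u) (weylGroup.ofIdx P a * v)
      (d + b.affineShift a v - b.affineShift a u) := by
  have := ha.hasPath_lowerRep h
  simp only [lowerRep, lowerWeight, hu, hv, if_false] at this
  exact this.cast rfl (by abel)

theorem IsAffineSimple.hasLeastWeight_of_not_of_not {a : ι} (ha : b.IsAffineSimple a)
    {u v : P.weylGroup} (hu : ¬ b.IsPos (u⁻¹ • a)) (hv : ¬ b.IsPos (v⁻¹ • a))
    (h : b.HasLeastWeight (weylGroup.ofIdx P a * u) (weylGroup.ofIdx P a * v)) :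
    b.HasLeastWeight u v := by
  obtain ⟨d, hd, hmin⟩ := h
  have h1 : b.IsPos ((weylGroup.ofIdx P a * u)⁻¹ • a) := by
    rwa [ofIdx_mul_inv_smul, isPos_negIndex_iff]
  have h2 : b.IsPos ((weylGroup.ofIdx P a * v)⁻¹ • a) := by
    rwa [ofIdx_mul_inv_smul, isPos_negIndex_iff]
  have := ha.hasPath_upperRep hd
  simp only [upperRep, upperWeight, h1, h2, if_true, ofIdx_mul_ofIdx_mul,
    affineShift_ofIdx_mul] at this
  refine ⟨_, this, fun e he => ?_⟩
  have hle := hmin _ (ha.hasPath_of_not_of_not hu hv he)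
  calc d + -b.affineShift a v - -b.affineShift a u
      = d + (b.affineShift a u - b.affineShift a v) := by abel
    _ ≤ (e + b.affineShift a v - b.affineShift a u) + (b.affineShift a u - b.affineShift a v) := by
        gcongr
    _ = e := by abel

end Least

end RootPairing.Base

/-! ### Existence of a least weight -/

namespace RootPairing.Base

section Descent

variable {ι R M N : Type*} [Field R] [CharZero R] [AddCommGroup M] [Module R M]
  [AddCommGroup N] [Module R N] {P : RootPairing ι R M N} (b : P.Base)

/-- For `v` in the Weyl group and a linear form `m` on the root lattice, which play the role of an
element of the affine Weyl group, the number of hyperplanes orthogonal to the positive root `i`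
that are still to be crossed, counted with sign. -/
noncomputable def crossings (v : P.weylGroup) (m : P.rootSpan ℤ →ₗ[ℤ] ℤ) (i : ι) : ℤ :=
  m (P.rootSpanMem ℤ i) + b.negInd (v • i)

theorem crossings_negIndex (v : P.weylGroup) (m : P.rootSpan ℤ →ₗ[ℤ] ℤ) (i : ι) :
    b.crossings v m (P.negIndex i) = 1 - b.crossings v m i := by
  have : P.rootSpanMem ℤ (P.negIndex i) = -P.rootSpanMem ℤ i := Subtype.ext (root_negIndex i)
  rw [crossings, crossings, this, map_neg, smul_negIndex, negInd_negIndex]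
  ring

variable {b} [P.IsCrystallographic]

open Classical in
/-- Left multiplication by an affine simple reflection crosses a single hyperplane. -/
theorem IsAffineSimple.crossings_mul {a : ι} (ha : b.IsAffineSimple a) (v : P.weylGroup)
    (m : P.rootSpan ℤ →ₗ[ℤ] ℤ) (i : ι) :
    b.crossings (weylGroup.ofIdx P a * v) (m + b.negInd a • P.coroot'In ℤ (v⁻¹ • a)) i =
      b.crossings v m i + (if i = v⁻¹ • a then 1 else 0) -
        (if i = P.negIndex (v⁻¹ • a) then 1 else 0) := by
  rw [crossings, crossings, mul_smul, ofIdx_smul_index, ha (v • i), LinearMap.add_apply,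
    LinearMap.smul_apply, P.coroot'In_rootSpanMem_eq_pairingIn, pairingIn_inv_smul,
    ← smul_negIndex]
  simp only [eq_inv_smul_iff, smul_eq_mul]
  ring

variable [Finite ι] [P.IsReduced]

/-- If no affine simple reflection leads across a hyperplane that remains to be crossed, then for
each positive root there are at most two of these. -/
theorem crossings_le_two {v : P.weylGroup} {m : P.rootSpan ℤ →ₗ[ℤ] ℤ}
    (h0 : ∀ i, b.IsPos i → 0 ≤ b.crossings v m i)
    (h : ∀ a, b.IsAffineSimple a → ¬ b.IsPos (v⁻¹ • a) →
      b.crossings v m (P.negIndex (v⁻¹ • a)) ≤ 0) (i : ι) :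
    b.crossings v m i ≤ 2 := by
  -- the linear form `f = m ∘ v⁻¹` takes values in `{0, 1}` on the positive roots
  set f : ι → ℤ := fun k => m (P.rootSpanMem ℤ (v⁻¹ • k)) with hf
  have hc : ∀ k, b.crossings v m (v⁻¹ • k) = f k + b.negInd k := fun k => by
    rw [crossings, smul_inv_smul]
  have hsum : ∀ k, f k = ∑ j : b.support, b.rootCoords k j * f j := fun k => by
    simp only [hf]
    rw [b.rootSpanMem_smul, map_sum]
    exact Finset.sum_congr rfl fun j _ => by rw [map_smul, smul_eq_mul]
  have hsimple : ∀ j : b.support, 0 ≤ f j := fun j => by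
    have hcj := hc j
    rw [negInd_of_isPos (isPos_of_mem_support j.2)] at hcj
    by_cases hj : b.IsPos (v⁻¹ • (j : ι))
    · have := h0 _ hj
      omega
    · have := h _ (b.isAffineSimple_of_mem_support j.2) hj
      rw [crossings_negIndex] at this
      omega
  have hmono : ∀ k l, b.rootCoords k ≤ b.rootCoords l → f k ≤ f l := fun k l hkl => by
    rw [hsum k, hsum l]
    exact Finset.sum_le_sum fun j _ => mul_le_mul_of_nonneg_right (hkl j) (hsimple j)
  have hle : ∀ k, b.IsPos k → f k ≤ 1 := fun k hk => by
    obtain ⟨θ, hθ, haff, hkθ⟩ := b.exists_maximal_root k hk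
    refine (hmono k θ hkθ).trans ?_
    have hcθ := hc θ
    rw [negInd_of_isPos hθ] at hcθ
    by_cases hv : b.IsPos (v⁻¹ • θ)
    · have := h _ haff (by
        rw [smul_negIndex, isPos_negIndex_iff]
        exact not_not.2 hv)
      rw [smul_negIndex, negIndex_negIndex] at this
      omega
    · have := h0 _ ((b.isPos_negIndex_iff _).2 hv)
      rw [crossings_negIndex] at this
      omega
  have hge : ∀ k, b.IsPos k → 0 ≤ f k := fun k hk => by
    rw [hsum k]
    exact Finset.sum_nonneg fun j _ => mul_nonneg (hk.rootCoords_nonneg j) (hsimple j)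
  have hi := hc (v • i)
  rw [inv_smul_smul] at hi
  by_cases hp : b.IsPos (v • i)
  · have := hle _ hp
    rw [negInd_of_isPos hp] at hi
    omega
  · have h1 := hge _ ((b.isPos_negIndex_iff _).2 hp)
    have h2 : f (P.negIndex (v • i)) = -f (v • i) := by
      have := hc (P.negIndex (v • i))
      rw [smul_negIndex, inv_smul_smul, crossings_negIndex, negInd_negIndex] at this
      omega
    rw [negInd_of_not_isPos hp] at hi
    omega

/-- The inner induction: starting at `(v y, v)` with `y ≠ 1`, affine simple reflections that lower
both components are applied, until one is found that lowers the second component only. -/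
theorem hasLeastWeight_of_crossings {n : ℕ}
    (ih : ∀ u v d, b.HasPath u v d →
      (b.weylLength v : ℤ) - b.weylLength u + 2 * ∑ j, d j < n → b.HasLeastWeight u v)
    {y : P.weylGroup} {γ : ι} (hγ : b.IsPos γ) (hy : ¬ b.IsPos (y⁻¹ • γ)) (k : ℕ)
    (v : P.weylGroup) (m : P.rootSpan ℤ →ₗ[ℤ] ℤ) (hk : ∑ i ∈ b.posRoots, b.crossings v m i ≤ k)
    (h0 : ∀ i, b.IsPos i → 0 ≤ b.crossings v m i) (h3 : 3 ≤ b.crossings v m γ)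
    (d : b.support →₀ ℤ) (hd : b.HasPath (v * y) v d)
    (hn : (b.weylLength v : ℤ) - b.weylLength (v * y) + 2 * ∑ j, d j ≤ n) :
    b.HasLeastWeight (v * y) v := by
  classical
  induction k generalizing v m d with
  | zero =>
    have := Finset.single_le_sum (fun i hi => h0 i (mem_posRoots.1 hi)) (mem_posRoots.2 hγ)
    simp only [Nat.cast_zero] at hk
    omega
  | succ k ihk =>
    obtain ⟨a, ha, hv, hpos⟩ : ∃ a, b.IsAffineSimple a ∧ ¬ b.IsPos (v⁻¹ • a) ∧
        0 < b.crossings v m (P.negIndex (v⁻¹ • a)) := by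
      by_contra! hcon
      have := crossings_le_two h0 hcon γ
      omega
    have hlv := ha.weylLength_mul v
    rw [negInd_of_not_isPos hv] at hlv
    by_cases hu : b.IsPos ((v * y)⁻¹ • a)
    · refine ha.hasLeastWeight_of_isPos_of_not hu hv
        (ih _ _ _ (ha.hasPath_of_isPos_of_not hu hv hd) ?_)
      simp only [Finsupp.add_apply, Finset.sum_add_distrib, sum_affineShift]
      linarith
    · have hlu := ha.weylLength_mul (v * y)
      rw [negInd_of_not_isPos hu] at hlu
      refine ha.hasLeastWeight_of_not_of_not hu hv ?_
      have hd' := ha.hasPath_of_not_of_not hu hv hd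
      have hc := ha.crossings_mul v m
      -- as both components are lowered, the hyperplane crossed is not orthogonal to `γ`
      have hne : γ ≠ P.negIndex (v⁻¹ • a) := by
        rintro rfl
        rw [smul_negIndex, isPos_negIndex_iff, not_not, ← mul_smul, ← mul_inv_rev] at hy
        exact hu hy
      have hne' : ∀ i, b.IsPos i → i ≠ v⁻¹ • a := by
        rintro i hi rfl
        exact hv hi
      rw [← mul_assoc] at hd' hlu ⊢
      refine ihk (weylGroup.ofIdx P a * v) (m + b.negInd a • P.coroot'In ℤ (v⁻¹ • a)) ?_ ?_ ?_ _
        hd' ?_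
      · have hsum : ∑ i ∈ b.posRoots, b.crossings (weylGroup.ofIdx P a * v)
            (m + b.negInd a • P.coroot'In ℤ (v⁻¹ • a)) i =
            ∑ i ∈ b.posRoots, b.crossings v m i - 1 := by
          simp only [hc, Finset.sum_sub_distrib, Finset.sum_add_distrib, Finset.sum_ite_eq',
            mem_posRoots, isPos_negIndex_iff, hv, if_false, not_false_eq_true, if_true, add_zero]
        rw [hsum]
        push_cast at hk
        omega
      · intro i hi
        rw [hc, if_neg (hne' i hi)]
        have := h0 i hi
        split_ifs with hia
        · subst hia
          omega
        · omega
      · rw [hc, if_neg (hne' γ hγ), if_neg hne]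
        omega
      · simp only [Finsupp.add_apply, Finsupp.sub_apply, Finset.sum_add_distrib,
          Finset.sum_sub_distrib, sum_affineShift]
        linarith

theorem exists_isPos_not_isPos_smul {w : P.weylGroup} (hw : w ≠ 1) :
    ∃ γ, b.IsPos γ ∧ ¬ b.IsPos (w • γ) := by
  by_contra! h
  have hl : (b.weylLength w : ℤ) = 0 := by
    rw [weylLength_eq_numInversions]
    exact Finset.sum_eq_zero fun i hi => negInd_of_isPos (h i (mem_posRoots.1 hi))
  obtain ⟨l, hl', rfl⟩ := b.exists_reduced_word w
  rw [← hl', Nat.cast_eq_zero, List.length_eq_zero_iff] at hl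
  subst hl
  simp at hw

theorem HasPath.nonneg {u v : P.weylGroup} {d : b.support →₀ ℤ} (h : b.HasPath u v d) :
    0 ≤ d := by
  induction h with
  | refl => exact le_rfl
  | @tail v d γ _ hs ih =>
    refine add_nonneg ih ?_
    by_cases hp : b.IsPos (v • γ)
    · rw [stepWeight_of_isPos hp]
    · rw [stepWeight_of_not_isPos hp]
      exact hs.1.corootCoords_nonneg

theorem hasLeastWeight_self (u : P.weylGroup) : b.HasLeastWeight u u :=
  ⟨0, HasPath.refl, fun _ he => he.nonneg⟩

/-- The outer induction is on the number of edges of some path from `u` to `v`. -/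
theorem hasLeastWeight (u v : P.weylGroup) : b.HasLeastWeight u v := by
  suffices key : ∀ (n : ℕ) u v d, b.HasPath u v d →
      (b.weylLength v : ℤ) - b.weylLength u + 2 * ∑ j, d j < n → b.HasLeastWeight u v by
    obtain ⟨d, hd⟩ := b.exists_hasPath u v
    exact key (((b.weylLength v : ℤ) - b.weylLength u + 2 * ∑ j, d j).toNat + 1) u v d hd
      (by push_cast; have := Int.self_le_toNat ((b.weylLength v : ℤ) - b.weylLength u +
        2 * ∑ j, d j); omega)
  intro n
  induction n with
  | zero =>
    intro u v d hd hn
    have := hd.length_nonneg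
    simp only [Nat.cast_zero] at hn
    omega
  | succ n ih =>
    intro u v d hd hn
    rcases eq_or_ne u v with rfl | huv
    · exact hasLeastWeight_self u
    obtain ⟨γ, hγ, hy⟩ := exists_isPos_not_isPos_smul (b := b) (w := (v⁻¹ * u)⁻¹) (by
      rw [ne_eq, inv_eq_one, inv_mul_eq_one]
      exact huv.symm)
    obtain ⟨y, rfl⟩ : ∃ y, u = v * y := ⟨v⁻¹ * u, by group⟩
    rw [inv_mul_cancel_left] at hy
    -- a linear form that is large on all positive roots
    set m : P.rootSpan ℤ →ₗ[ℤ] ℤ := b.toWeightBasisInt.constr ℤ (fun _ => (3 : ℤ)) with hm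
    have hmi : ∀ i, b.IsPos i → 3 ≤ b.crossings v m i := fun i hi => by
      obtain ⟨j, hj⟩ := Finsupp.ne_iff.1 (b.rootCoords_ne_zero i)
      have hmj : m (P.rootSpanMem ℤ i) = ∑ j, b.rootCoords i j * 3 := by
        rw [hm, Module.Basis.constr_apply_fintype]; rfl
      have h1 : 1 ≤ b.rootCoords i j :=
        lt_of_le_of_ne (hi.rootCoords_nonneg j) (by simpa using hj.symm)
      have h2 := Finset.single_le_sum (f := fun j => b.rootCoords i j * 3)
        (fun k _ => mul_nonneg (hi.rootCoords_nonneg k) (by norm_num)) (Finset.mem_univ j)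
      have h3 : 0 ≤ b.negInd (v • i) := by
        by_cases hp : b.IsPos (v • i) <;> simp [negInd, hp]
      rw [crossings, hmj]
      omega
    exact hasLeastWeight_of_crossings ih hγ hy (∑ i ∈ b.posRoots, b.crossings v m i).toNat v m
      (Int.self_le_toNat _) (fun i hi => by have := hmi i hi; omega) (hmi γ hγ) d hd
      (by push_cast at hn; omega)

end Descent
end RootPairing.Base

/-! ### Paths in the quiver -/

namespace RootPairing.Base

section QuiverPaths

variable {ι R M N : Type*} [Finite ι] [Field R] [CharZero R] [AddCommGroup M] [Module R M]
  [AddCommGroup N] [Module R N] {P : RootPairing ι R M N} [P.IsCrystallographic] [P.IsReduced]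
  {b : P.Base}

/-- The path `p` has weight `q ^ e`, and this is recorded by `HasPath`; the number of edges of `p`
is the one that the lengths of the end points and `e` determine. -/
structure HasExponent {u v : b.QuantumBruhatGraph} (p : Quiver.Path u v)
    (e : b.support →₀ ℕ) : Prop where
  weight_eq : b.pathWeight p = b.qMonomial e
  hasPath : b.HasPath u v (e.mapRange (Nat.cast : ℕ → ℤ) Nat.cast_zero)
  length_eq : (p.length : ℤ) = b.weylLength v - b.weylLength u + 2 * ∑ j, (e j : ℤ)

omit [Finite ι] [CharZero R] [P.IsCrystallographic] [P.IsReduced] in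
theorem qMonomial_add (d e : b.support →₀ ℕ) :
    b.qMonomial (d + e) = b.qMonomial d * b.qMonomial e := by
  simp [qMonomial, MvPolynomial.monomial_mul]

theorem QuantumBruhatEdge.length_eq_iff {u v : P.weylGroup} (a : b.QuantumBruhatEdge u v) :
    b.weylLength v = b.weylLength u + 1 ↔ b.IsPos (u • a.root) := by
  have hle := a.length_eq
  rw [← a.isPos.corootHt_eq] at hle
  have h1 := a.isPos.one_le_corootHt
  by_cases h : b.IsPos (u • a.root)
  · have := b.weylLength_lt_mul_ofIdx a.isPos h
    rw [← a.eq_mul] at this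
    simp only [h, iff_true]
    omega
  · have := b.weylLength_mul_ofIdx_lt a.isPos h
    rw [← a.eq_mul] at this
    simp only [h, iff_false]
    omega

theorem QuantumBruhatEdge.isStep {u v : P.weylGroup} (a : b.QuantumBruhatEdge u v) :
    b.IsStep u a.root := by
  have hle := a.length_eq
  have hiff := a.length_eq_iff
  rw [← a.isPos.corootHt_eq] at hle
  have h1 := a.isPos.one_le_corootHt
  refine ⟨a.isPos, ?_⟩
  rw [← a.eq_mul]
  by_cases h : b.IsPos (u • a.root)
  · rw [negInd_of_isPos h]
    have := hiff.2 h
    omega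
  · rw [negInd_of_not_isPos h]
    have := mt hiff.1 h
    omega

theorem HasExponent.cons {u v w : b.QuantumBruhatGraph} {p : Quiver.Path u v}
    {e : b.support →₀ ℕ} (h : HasExponent p e) (a : v ⟶ w) :
    ∃ e', HasExponent (p.cons a) e' ∧ e'.mapRange (Nat.cast : ℕ → ℤ) Nat.cast_zero =
      e.mapRange (Nat.cast : ℕ → ℤ) Nat.cast_zero +
        b.stepWeight v (QuantumBruhatEdge.root a) := by
  have hs := QuantumBruhatEdge.isStep a
  have hiff := QuantumBruhatEdge.length_eq_iff a
  have hγ := hs.1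
  set γ := QuantumBruhatEdge.root a
  have hw : b.pathWeight (p.cons a) = b.qMonomial e * b.edgeWeight a := by
    rw [← h.weight_eq, pathWeight, Quiver.Path.weight_cons]; rfl
  have hp := (h.hasPath.tail hs).cast (QuantumBruhatEdge.eq_mul a).symm rfl
  have hlen := h.length_eq
  have hl := hs.2
  rw [← QuantumBruhatEdge.eq_mul a] at hl
  by_cases hpos : b.IsPos ((show P.weylGroup from v) • γ)
  · have hsw : b.stepWeight v γ = 0 := stepWeight_of_isPos hpos
    rw [hsw, add_zero] at hp
    refine ⟨e, ⟨?_, hp, ?_⟩, ?_⟩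
    · rw [hw, edgeWeight, if_pos (hiff.2 hpos), mul_one]
    · rw [negInd_of_isPos hpos] at hl
      rw [Quiver.Path.length_cons]
      push_cast
      omega
    · exact (hsw ▸ add_zero _).symm
  · have hsw : (e + b.corootExponent γ).mapRange (Nat.cast : ℕ → ℤ) Nat.cast_zero =
        e.mapRange (Nat.cast : ℕ → ℤ) Nat.cast_zero + b.stepWeight v γ := by
      rw [(stepWeight_of_not_isPos hpos).trans hγ.corootCoords_eq]
      ext j
      simp
    rw [← hsw] at hp
    refine ⟨e + b.corootExponent γ, ⟨?_, hp, ?_⟩, hsw⟩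
    · rw [hw, edgeWeight, if_neg (fun h => hpos (hiff.1 h)), qMonomial_add]
    · rw [negInd_of_not_isPos hpos, hγ.corootHt_eq, corootHeight] at hl
      rw [Quiver.Path.length_cons]
      simp only [Finsupp.add_apply, Nat.cast_add, Finset.sum_add_distrib]
      push_cast at hl ⊢
      omega

omit [Finite ι] [P.IsCrystallographic] [P.IsReduced] in
theorem hasExponent_nil (u : b.QuantumBruhatGraph) :
    HasExponent (Quiver.Path.nil : Quiver.Path u u) 0 where
  weight_eq := by simp [pathWeight, qMonomial]
  hasPath := HasPath.refl.cast rfl (by simp)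
  length_eq := by simp

theorem exists_hasExponent {u v : b.QuantumBruhatGraph} (p : Quiver.Path u v) :
    ∃ e, HasExponent p e := by
  induction p with
  | nil => exact ⟨0, hasExponent_nil _⟩
  | cons p a ih =>
    obtain ⟨e, he⟩ := ih
    obtain ⟨e', he', -⟩ := he.cons a
    exact ⟨e', he'⟩

theorem IsStep.length_eq {v : P.weylGroup} {γ : ι} (hs : b.IsStep v γ) :
    (b.weylLength (v * weylGroup.ofIdx P γ) : ℤ) = b.weylLength v + 1 ∨
      (b.weylLength (v * weylGroup.ofIdx P γ) : ℤ) =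
        b.weylLength v + 1 - 2 * b.corootHeight γ := by
  have hl := hs.2
  rw [hs.1.corootHt_eq] at hl
  by_cases hpos : b.IsPos (v • γ)
  · rw [negInd_of_isPos hpos] at hl
    left; omega
  · rw [negInd_of_not_isPos hpos] at hl
    right; omega

theorem HasPath.exists_path {u v : P.weylGroup} {d : b.support →₀ ℤ} (h : b.HasPath u v d) :
    ∃ (p : @Quiver.Path b.QuantumBruhatGraph _ u v) (e : b.support →₀ ℕ),
      HasExponent p e ∧ e.mapRange (Nat.cast : ℕ → ℤ) Nat.cast_zero = d := by
  induction h with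
  | refl => exact ⟨Quiver.Path.nil, 0, hasExponent_nil (b := b) u, by simp⟩
  | @tail v d γ _ hs ih =>
    obtain ⟨p, e, he, rfl⟩ := ih
    let a : b.QuantumBruhatEdge v (v * weylGroup.ofIdx P γ) := ⟨γ, hs.1, rfl, hs.length_eq⟩
    obtain ⟨e', he', h⟩ := he.cons a
    exact ⟨_, e', he', h⟩

end QuiverPaths

end RootPairing.Base

theorem mainTheorem5 {ι R M N : Type*} [Finite ι] [Field R] [CharZero R]
    [AddCommGroup M] [Module R M] [AddCommGroup N] [Module R N]
    (P : RootPairing ι R M N) [P.IsRootSystem] [P.IsCrystallographic] [P.IsReduced]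
    (b : P.Base) (u v : b.QuantumBruhatGraph) :
    Nonempty (Quiver.Path u v) ∧
      ∃ d_min : b.support →₀ ℕ,
        (∀ p : Quiver.Path u v, b.IsShortestPath p → b.pathWeight p = b.qMonomial d_min) ∧
        (∀ p : Quiver.Path u v, b.qMonomial d_min ∣ b.pathWeight p) := by
  obtain ⟨d, hd, hmin⟩ := RootPairing.Base.hasLeastWeight (b := b) u v
  obtain ⟨p₀, e₀, hp₀, rfl⟩ := hd.exists_path
  have hle : ∀ {p : Quiver.Path u v} {e : b.support →₀ ℕ},
      RootPairing.Base.HasExponent p e → e₀ ≤ e := by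
    intro p e he j
    have := hmin _ he.hasPath j
    simpa using this
  refine ⟨⟨p₀⟩, e₀, fun p hp => ?_, fun p => ?_⟩
  · obtain ⟨e, he⟩ := RootPairing.Base.exists_hasExponent p
    have hsum : ∑ j, e j ≤ ∑ j, e₀ j := by
      have h1 := hp p₀
      have h2 := he.length_eq
      have h3 := hp₀.length_eq
      zify
      omega
    have heq : e₀ = e := by
      have := (Finset.sum_eq_sum_iff_of_le fun j _ => hle he j).1
        (le_antisymm (Finset.sum_le_sum fun j _ => hle he j) hsum)
      exact Finsupp.ext fun j => this j (Finset.mem_univ j)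
    rw [he.weight_eq, heq]
  · obtain ⟨e, he⟩ := RootPairing.Base.exists_hasExponent p
    rw [he.weight_eq, ← add_tsub_cancel_of_le (hle he), RootPairing.Base.qMonomial_add]
    exact dvd_mul_right _ _
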